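/- Let $\xi_1,\xi_2,\dots$ be independent random vectors, each taking the values $(0,1),(0,-1),(1,0),(-1,0)$ with probability $1/4$ each, and let $S_0=(0,0)$, $S_n=\sum_{i=1}^n \xi_i$ be the planar simple random walk. Put $\varsigma_0=0$ and $\varsigma_l=\min\{k>\varsigma_{l-1}: S_k=(0,0)\}$ for $l\ge 1$ (with $\varsigma_l=\infty$ if there is no such $k$). For $n\ge 1$ let $L=L_n=\max\{l:\varsigma_l\le n\}$, and for $1\le l\le L$ let $\rho_l=\varsigma_l-\varsigma_{l-1}$ be the length of the $l$th excursion from the origin completed by time $n$. Then, as $n\to\infty$, $$\frac{\log \max_{1\le l\le L}\rho_l}{\log n}$$ converges weakly (in distribution) to a random variable uniformly distributed on $[0,1]$. Here the quotient is taken to be $0$ when $L=0$ or $n = 1$. -/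

import Mathlib

open MeasureTheory ProbabilityTheory Filter

namespace PlanarWalk

/-- The partial sums `S_n = ξ_1 + ⋯ + ξ_n`, `S_0 = (0,0)`. Steps are indexed from `0`, so that
`ξ i` is the step taken between times `i` and `i + 1`. -/
def walk {Ω : Type*} (ξ : ℕ → Ω → ℤ × ℤ) (ω : Ω) (n : ℕ) : ℤ × ℤ :=
  ∑ i ∈ Finset.range n, ξ i ω

/-- The steps of the planar simple random walk: independent random variables, each of which takes
the four values `(0,1), (0,-1), (1,0), (-1,0)` with probability `1/4` each. -/
structure IsSimpleStep {Ω : Type*} [MeasurableSpace Ω] (P : Measure Ω)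
    (ξ : ℕ → Ω → ℤ × ℤ) : Prop where
  measurable : ∀ i, Measurable (ξ i)
  indep : iIndepFun ξ P
  up : ∀ i, P {ω | ξ i ω = (0, 1)} = 1 / 4
  down : ∀ i, P {ω | ξ i ω = (0, -1)} = 1 / 4
  right : ∀ i, P {ω | ξ i ω = (1, 0)} = 1 / 4
  left : ∀ i, P {ω | ξ i ω = (-1, 0)} = 1 / 4

/-- The time `ς_l` of the `l`-th return of the path `s` to the origin: `ς_0 = 0` and
`ς_l = min {k > ς_{l-1} : s_k = 0}`, with value `⊤` if there is no such return. -/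
noncomputable def returnTime (s : ℕ → ℤ × ℤ) : ℕ → ℕ∞
  | 0 => 0
  | l + 1 => sInf {t : ℕ∞ | ∃ k : ℕ, t = k ∧ returnTime s l < k ∧ s k = 0}

/-- The number `L = max {l : ς_l ≤ n}` of excursions completed by time `n`. -/
noncomputable def numExcursions (s : ℕ → ℤ × ℤ) (n : ℕ) : ℕ :=
  sSup {l : ℕ | returnTime s l ≤ n}

/-- The length `ρ_l = ς_l - ς_{l-1}` of the `l`-th excursion (used for `1 ≤ l ≤ L` only, where both
return times are finite). -/
noncomputable def excursionLength (s : ℕ → ℤ × ℤ) (l : ℕ) : ℕ :=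
  (returnTime s l - returnTime s (l - 1)).toNat

/-- The length `max_{1 ≤ l ≤ L} ρ_l` of the longest excursion completed by time `n`
(`0` if there is none). -/
noncomputable def maxExcursion (s : ℕ → ℤ × ℤ) (n : ℕ) : ℕ :=
  (Finset.Icc 1 (numExcursions s n)).sup (excursionLength s)

lemma le_returnTime (s : ℕ → ℤ × ℤ) (l : ℕ) : (l : ℕ∞) ≤ returnTime s l := by
  induction l with
  | zero => simp
  | succ l ih =>
    rw [returnTime]
    refine le_sInf ?_
    rintro t ⟨k, rfl, hk, -⟩
    have h : l < k := by exact_mod_cast ih.trans_lt hk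
    exact_mod_cast h

/-- The maximum that defines `L` is attained. -/
lemma isGreatest_numExcursions (s : ℕ → ℤ × ℤ) (n : ℕ) :
    IsGreatest {l : ℕ | returnTime s l ≤ n} (numExcursions s n) := by
  have hb : BddAbove {l : ℕ | returnTime s l ≤ n} :=
    ⟨n, fun l hl => by exact_mod_cast (le_returnTime s l).trans hl⟩
  have hne : {l : ℕ | returnTime s l ≤ n}.Nonempty := ⟨0, by simp [returnTime]⟩
  exact ⟨Nat.sSup_mem hne hb, fun l hl => le_csSup hb hl⟩

end PlanarWalk

/-! The event that the longest completed excursion is at most `m` says that consecutive zeros of the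
path up to time `n` are at most `m` apart (`maxExcursion_le_iff`). Splitting at the last zero `k ≤
n` gives its probability as `∑ u k * r (n - k)` (`real_gapsLE_eq`). Here `r` is the tail of the
first return time, and `u k` is the probability that `k` is a zero preceded only by gaps of length
at most `m`.

The sequence `u` is a renewal sequence whose inter-arrival law has been cut at `m` and so has mass
`1 - r m`. Its total mass is therefore about `1 / r m`. The first moment of `u` is at most `m / r m
^ 2`, so for `m = n ^ x` with `x < 1` nearly all of that mass sits at times `o(n)`. Hence the sum is
asymptotic to `r n / r m` (`conv_le`, `le_conv`, `tendsto_conv_truncatedRenewal`).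

The tail satisfies `r n ∼ C / log n` (`exists_tendsto_tail_mul_log`), so this ratio tends to `log m
/ log n → x`, the uniform distribution function. The tail estimate comes from `∑ p k * r (n - k) =
1`, where `p` is the return probability. This identity forces `r n` times the Green function to tend
to 1. The Green function grows like `log n` because `p (2 * k)` is the square of a central binomial
weight, of order `1 / k` (`real_path_eq`). The constant `C` cancels in the ratio and is never
computed. -/

namespace PlanarWalk
open scoped Topology

/-! ### Excursion lengths as gaps between zeros -/

/-- Any two consecutive zeros of the path `s` up to time `n` are at distance at most `m`. -/
def GapsLE (s : ℕ → ℤ × ℤ) (m n : ℕ) : Prop :=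
  ∀ a b, a < b → b ≤ n → s a = 0 → s b = 0 → (∀ c, a < c → c < b → s c ≠ 0) → b ≤ a + m

lemma returnTime_succ_eq {s : ℕ → ℤ × ℤ} {l a b : ℕ} (hl : returnTime s l = a) (hab : a < b)
    (hb : s b = 0) (hc : ∀ c, a < c → c < b → s c ≠ 0) : returnTime s (l + 1) = b := by
  rw [returnTime]
  refine le_antisymm (sInf_le ⟨b, rfl, by rw [hl]; exact_mod_cast hab, hb⟩) (le_sInf ?_)
  rintro t ⟨k, rfl, hk, hk0⟩
  rw [hl] at hk
  have hk' : a < k := by exact_mod_cast hk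
  by_contra h
  exact hc k hk' (by exact_mod_cast not_le.1 h) hk0

lemma exists_last_zero {s : ℕ → ℤ × ℤ} (h0 : s 0 = 0) (n : ℕ) :
    ∃ k ≤ n, s k = 0 ∧ ∀ c, k < c → c ≤ n → s c ≠ 0 := by
  classical
  refine ⟨Nat.findGreatest (fun k => s k = 0) n, Nat.findGreatest_le n, ?_, ?_⟩
  · exact Nat.findGreatest_spec (P := fun k => s k = 0) (Nat.zero_le n) h0
  · intro c hc hcn
    exact Nat.findGreatest_is_greatest hc hcn

lemma exists_returnTime_eq {s : ℕ → ℤ × ℤ} (h0 : s 0 = 0) (a : ℕ) (ha : s a = 0) :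
    ∃ l, returnTime s l = a := by
  induction a using Nat.strong_induction_on with
  | _ a ih =>
    rcases a with _ | a
    · exact ⟨0, by simp [returnTime]⟩
    · obtain ⟨k, hk, hk0, hc⟩ := exists_last_zero h0 a
      obtain ⟨l, hl⟩ := ih k (by omega) hk0
      exact ⟨l + 1, returnTime_succ_eq hl (by omega) ha fun c h1 h2 => hc c h1 (by omega)⟩

lemma returnTime_le_succ (s : ℕ → ℤ × ℤ) (l : ℕ) : returnTime s l ≤ returnTime s (l + 1) := by
  rw [returnTime]
  refine le_sInf ?_
  rintro t ⟨k, rfl, hk, -⟩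
  exact hk.le

lemma exists_of_returnTime_succ_eq {s : ℕ → ℤ × ℤ} {l b : ℕ} (hb : returnTime s (l + 1) = b) :
    returnTime s l < b ∧ s b = 0 ∧ ∀ c : ℕ, returnTime s l < c → c < b → s c ≠ 0 := by
  have hne : {t : ℕ∞ | ∃ k : ℕ, t = k ∧ returnTime s l < k ∧ s k = 0}.Nonempty := by
    by_contra h
    rw [Set.not_nonempty_iff_eq_empty] at h
    rw [returnTime, h, sInf_empty] at hb
    exact ENat.natCast_ne_top b hb.symm
  obtain ⟨k, hk, hk1, hk2⟩ := csInf_mem hne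
  have hkb : k = b := by
    rw [returnTime, hk] at hb
    exact_mod_cast hb
  subst hkb
  refine ⟨hk1, hk2, fun c h1 h2 h3 => ?_⟩
  have h4 : returnTime s (l + 1) ≤ c := by
    rw [returnTime]
    exact sInf_le ⟨c, rfl, h1, h3⟩
  rw [hb] at h4
  exact absurd h2 (not_lt.2 (by exact_mod_cast h4))

lemma zero_of_returnTime_eq {s : ℕ → ℤ × ℤ} (h0 : s 0 = 0) {l a : ℕ} (ha : returnTime s l = a) :
    s a = 0 := by
  rcases l with _ | l
  · have : a = 0 := by
      rw [returnTime] at ha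
      exact_mod_cast ha.symm
    rw [this, h0]
  · exact (exists_of_returnTime_succ_eq ha).2.1

/-- This trades the recursively enumerated return times for a condition on the path up to time `n`,
which can be cut at a zero. With no completed excursion both sides hold vacuously. -/
lemma maxExcursion_le_iff {s : ℕ → ℤ × ℤ} (h0 : s 0 = 0) (m n : ℕ) :
    maxExcursion s n ≤ m ↔ GapsLE s m n := by
  have hL := isGreatest_numExcursions s n
  rw [maxExcursion, Finset.sup_le_iff]
  constructor
  · intro h a b hab hbn ha hb hc
    obtain ⟨l, hl⟩ := exists_returnTime_eq h0 a ha
    have hl' := returnTime_succ_eq hl hab hb hc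
    have hle : l + 1 ≤ numExcursions s n :=
      hL.2 (show returnTime s (l + 1) ≤ n by rw [hl']; exact_mod_cast hbn)
    have := h (l + 1) (Finset.mem_Icc.2 ⟨by omega, hle⟩)
    rw [excursionLength, hl', Nat.add_sub_cancel, hl, ← ENat.natCast_sub, ENat.toNat_natCast] at this
    omega
  · intro h l hl
    obtain ⟨h1, h2⟩ := Finset.mem_Icc.1 hl
    obtain ⟨l, rfl⟩ := Nat.exists_eq_add_of_le' h1
    have hn : returnTime s (l + 1) ≤ n :=
      (monotone_nat_of_le_succ (returnTime_le_succ s) h2).trans hL.1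
    obtain ⟨b, hb⟩ := ENat.ne_top_iff_exists.1 (ne_top_of_le_ne_top (ENat.natCast_ne_top n) hn)
    obtain ⟨a, ha⟩ := ENat.ne_top_iff_exists.1
      (ne_top_of_le_ne_top (ENat.natCast_ne_top n) ((returnTime_le_succ s l).trans hn))
    obtain ⟨h3, h4, h5⟩ := exists_of_returnTime_succ_eq hb.symm
    rw [← ha] at h3 h5
    rw [← hb] at hn
    have := h a b (by exact_mod_cast h3) (by exact_mod_cast hn) (zero_of_returnTime_eq h0 ha.symm)
      h4 fun c hc1 hc2 => h5 c (by exact_mod_cast hc1) hc2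
    rw [excursionLength, ← hb, Nat.add_sub_cancel, ← ha, ← ENat.natCast_sub, ENat.toNat_natCast]
    omega

lemma gapsLE_of_le {s : ℕ → ℤ × ℤ} {m n : ℕ} (h : n ≤ m) : GapsLE s m n :=
  fun a b _ hb _ _ _ => by omega

lemma GapsLE.mono {s : ℕ → ℤ × ℤ} {m n k : ℕ} (h : GapsLE s m n) (hk : k ≤ n) : GapsLE s m k :=
  fun a b hab hb => h a b hab (hb.trans hk)

/-- After the last zero `k` up to time `n`, no further gaps are completed. -/
lemma gapsLE_iff_of_last_zero {s : ℕ → ℤ × ℤ} {m n k : ℕ} (hkn : k ≤ n)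
    (hk : ∀ c, k < c → c ≤ n → s c ≠ 0) : GapsLE s m n ↔ GapsLE s m k := by
  refine ⟨fun h => h.mono hkn, fun h a b hab hb ha hb0 hc => h a b hab ?_ ha hb0 hc⟩
  by_contra hkb
  exact hk b (by omega) hb hb0

/-- If `k < n` are consecutive zeros, the gaps up to `n` are the gaps up to `k` and `n - k`. -/
lemma gapsLE_iff_of_consecutive {s : ℕ → ℤ × ℤ} {m n k : ℕ} (hkn : k < n) (hk0 : s k = 0)
    (hn0 : s n = 0) (hk : ∀ c, k < c → c < n → s c ≠ 0) :
    GapsLE s m n ↔ GapsLE s m k ∧ n ≤ k + m := by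
  refine ⟨fun h => ⟨h.mono hkn.le, h k n hkn le_rfl hk0 hn0 hk⟩, ?_⟩
  rintro ⟨h, hm⟩ a b hab hb ha hb0 hc
  rcases le_or_gt b k with hbk | hbk
  · exact h a b hab hbk ha hb0 hc
  · have hbn : b = n := by
      by_contra hbn
      exact hk b hbk (by omega) hb0
    have hak : k ≤ a := by
      by_contra hak
      exact hc k (by omega) hbk hk0
    omega


/-! ### Renewal sequences with truncated inter-arrival times -/

section Renewal

variable {r u : ℕ → ℝ} {m : ℕ}

/-- `u` is the renewal sequence of the inter-arrival law with tail `r`, restricted to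
inter-arrival times at most `m`. -/
structure IsTruncatedRenewal (r : ℕ → ℝ) (m : ℕ) (u : ℕ → ℝ) : Prop where
  nonneg : ∀ n, 0 ≤ u n
  zero : u 0 = 1
  succ : ∀ n, u (n + 1) =
    ∑ k ∈ Finset.range (n + 1), if n - k < m then u k * (r (n - k) - r (n - k + 1)) else 0

/-- Multiply the recursion by a weight and exchange the sums. The weight `1` yields the mass
balance, the weight `k` the first moment. -/
lemma IsTruncatedRenewal.sum_succ (hu : IsTruncatedRenewal r m u) (g : ℕ → ℝ) (N : ℕ) :
    ∑ n ∈ Finset.range N, g (n + 1) * u (n + 1) = ∑ k ∈ Finset.range N, u k *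
      ∑ i ∈ Finset.range (N - k), if i < m then g (k + i + 1) * (r i - r (i + 1)) else 0 := by
  simp_rw [Finset.mul_sum]
  rw [← Finset.sum_range_diag_flip N fun k i =>
    u k * if i < m then g (k + i + 1) * (r i - r (i + 1)) else 0]
  refine Finset.sum_congr rfl fun n _ => ?_
  rw [hu.succ, Finset.mul_sum]
  refine Finset.sum_congr rfl fun k hk => ?_
  rw [Finset.mem_range] at hk
  rw [show k + (n - k) + 1 = n + 1 by omega]
  split_ifs <;> ring

lemma sum_range_ite_lt (h : ℕ → ℝ) (m N : ℕ) :
    (∑ i ∈ Finset.range N, if i < m then h i else 0) = ∑ i ∈ Finset.range (min N m), h i := by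
  rw [← Finset.sum_filter]
  congr 1
  ext i
  simp

lemma sum_tail_sub_le (hr : Antitone r) (hr0 : r 0 = 1) (m N : ℕ) :
    (∑ i ∈ Finset.range N, if i < m then r i - r (i + 1) else 0) ≤ 1 - r m := by
  rw [sum_range_ite_lt, Finset.sum_range_sub', hr0]
  linarith [hr (min_le_right N m)]

lemma sum_tail_sub_eq (hr0 : r 0 = 1) {m N : ℕ} (h : m ≤ N) :
    (∑ i ∈ Finset.range N, if i < m then r i - r (i + 1) else 0) = 1 - r m := by
  rw [sum_range_ite_lt, Finset.sum_range_sub', hr0, min_eq_right h]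

/-- Each renewal has at most `1 - r m` expected successors, so the mass `W` satisfies `W ≤ 1 + (1 -
r m) * W`. -/
lemma IsTruncatedRenewal.mul_sum_le (hu : IsTruncatedRenewal r m u) (hr : Antitone r)
    (hr0 : r 0 = 1) (N : ℕ) : r m * ∑ k ∈ Finset.range (N + 1), u k ≤ 1 := by
  have h1 := hu.sum_succ (fun _ => 1) N
  simp only [one_mul] at h1
  have h2 : ∑ n ∈ Finset.range N, u (n + 1) ≤ ∑ k ∈ Finset.range N, u k * (1 - r m) := by
    rw [h1]
    exact Finset.sum_le_sum fun k _ =>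
      mul_le_mul_of_nonneg_left (sum_tail_sub_le hr hr0 m _) (hu.nonneg k)
  have h3 : ∑ k ∈ Finset.range N, u k ≤ ∑ k ∈ Finset.range (N + 1), u k :=
    Finset.sum_le_sum_of_subset_of_nonneg (Finset.range_subset_range.2 (by omega))
      fun k _ _ => hu.nonneg k
  have h4 : 0 ≤ 1 - r m := by linarith [hr (Nat.zero_le m)]
  rw [← Finset.sum_mul] at h2
  have h5 := Finset.sum_range_succ' u N
  rw [hu.zero] at h5
  nlinarith [mul_le_mul_of_nonneg_right h3 h4]

/-- A renewal at `k ≤ N - m` has all its possible successors within `N`, so it contributes the full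
`1 - r m`. -/
lemma IsTruncatedRenewal.le_mul_sum (hu : IsTruncatedRenewal r m u) (hr : Antitone r)
    (hr0 : r 0 = 1) {N : ℕ} (hm : m ≤ N) :
    1 + (1 - r m) * ∑ k ∈ Finset.range (N + 1 - m), u k ≤ ∑ k ∈ Finset.range (N + 1), u k := by
  -- The inclusion of `range (N + 1 - m)` in `range N` used below fails for `m = 0`.
  rcases Nat.eq_zero_or_pos m with rfl | hm0
  · rw [hr0, Finset.sum_range_succ', hu.zero]
    have := Finset.sum_nonneg fun k (_ : k ∈ Finset.range N) => hu.nonneg (k + 1)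
    linarith
  have h1 := hu.sum_succ (fun _ => 1) N
  simp only [one_mul] at h1
  rw [Finset.sum_range_succ', hu.zero, h1, add_comm, Finset.mul_sum]
  gcongr
  calc ∑ k ∈ Finset.range (N + 1 - m), (1 - r m) * u k
      = ∑ k ∈ Finset.range (N + 1 - m), u k *
        ∑ i ∈ Finset.range (N - k), if i < m then r i - r (i + 1) else 0 := by
        refine Finset.sum_congr rfl fun k hk => ?_
        rw [Finset.mem_range] at hk
        rw [sum_tail_sub_eq hr0 (by omega), mul_comm]
    _ ≤ _ := by
        refine Finset.sum_le_sum_of_subset_of_nonneg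
          (Finset.range_subset_range.2 (by omega)) fun k _ _ => ?_
        refine mul_nonneg (hu.nonneg k) (Finset.sum_nonneg fun i _ => ?_)
        split_ifs
        · linarith [hr (Nat.le_succ i)]
        · exact le_rfl

/-- A successor of `k` lies at most at `k + m`, so the moment `M` and mass `W` satisfy `M ≤ (1 - r
m) * (M + m * W)`. Hence `r m * M ≤ m * W`, and `r m * W ≤ 1`. -/
lemma IsTruncatedRenewal.first_moment_le (hu : IsTruncatedRenewal r m u) (hr : Antitone r)
    (hr0 : r 0 = 1) (hm : 0 ≤ r m) (N : ℕ) :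
    r m ^ 2 * ∑ k ∈ Finset.range (N + 1), (k : ℝ) * u k ≤ m := by
  have h1 := hu.sum_succ (fun k => (k : ℝ)) N
  have h4 : 0 ≤ 1 - r m := by linarith [hr (Nat.zero_le m)]
  have h2 : ∑ n ∈ Finset.range N, ((n + 1 : ℕ) : ℝ) * u (n + 1) ≤
      ∑ k ∈ Finset.range N, u k * ((k + m) * (1 - r m)) := by
    rw [h1]
    refine Finset.sum_le_sum fun k _ => mul_le_mul_of_nonneg_left ?_ (hu.nonneg k)
    refine le_trans ?_ (mul_le_mul_of_nonneg_left (sum_tail_sub_le hr hr0 m (N - k))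
      (by positivity))
    rw [Finset.mul_sum]
    refine Finset.sum_le_sum fun i _ => ?_
    split_ifs with hi
    · refine mul_le_mul_of_nonneg_right ?_ (by linarith [hr (Nat.le_succ i)])
      have : ((i + 1 : ℕ) : ℝ) ≤ m := by exact_mod_cast hi
      push_cast at this ⊢
      linarith
    · simp
  have h3 : ∑ k ∈ Finset.range N, (k : ℝ) * u k ≤ ∑ k ∈ Finset.range (N + 1), (k : ℝ) * u k :=
    Finset.sum_le_sum_of_subset_of_nonneg (Finset.range_subset_range.2 (by omega))
      fun k _ _ => mul_nonneg (by positivity) (hu.nonneg k)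
  have h3' : ∑ k ∈ Finset.range N, u k ≤ ∑ k ∈ Finset.range (N + 1), u k :=
    Finset.sum_le_sum_of_subset_of_nonneg (Finset.range_subset_range.2 (by omega))
      fun k _ _ => hu.nonneg k
  have h0 : 0 ≤ ∑ k ∈ Finset.range N, u k := Finset.sum_nonneg fun k _ => hu.nonneg k
  have h5 := Finset.sum_range_succ' (fun k => (k : ℝ) * u k) N
  have h6 : ∑ k ∈ Finset.range N, u k * ((k + m) * (1 - r m)) =
      (1 - r m) * ∑ k ∈ Finset.range N, (k : ℝ) * u k +
      (1 - r m) * m * ∑ k ∈ Finset.range N, u k := by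
    rw [Finset.mul_sum, Finset.mul_sum, ← Finset.sum_add_distrib]
    exact Finset.sum_congr rfl fun k _ => by ring
  simp only [Nat.cast_zero, zero_mul, add_zero] at h5
  have h7 := hu.mul_sum_le hr hr0 N
  set M := ∑ k ∈ Finset.range (N + 1), (k : ℝ) * u k
  set W := ∑ k ∈ Finset.range (N + 1), u k
  have h8 : r m * M ≤ m * W := by
    have e1 := mul_le_mul_of_nonneg_left h3 h4
    have e2 : (1 - r m) * m * ∑ k ∈ Finset.range N, u k ≤ m * W := by
      rw [mul_comm (1 - r m), mul_assoc]
      refine mul_le_mul_of_nonneg_left ?_ (by positivity)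
      nlinarith
    linarith
  calc r m ^ 2 * M = r m * (r m * M) := by ring
    _ ≤ r m * (m * W) := mul_le_mul_of_nonneg_left h8 hm
    _ = m * (r m * W) := by ring
    _ ≤ m * 1 := mul_le_mul_of_nonneg_left h7 (by positivity)
    _ = m := mul_one _

/-- The renewals after time `a` carry little mass. -/
lemma IsTruncatedRenewal.sum_Ico_le (hu : IsTruncatedRenewal r m u) (hr : Antitone r)
    (hr0 : r 0 = 1) (hm : 0 < r m) {a : ℕ} (ha : 0 < a) (N : ℕ) :
    ∑ k ∈ Finset.Ico a (N + 1), u k ≤ m / (a * r m ^ 2) := by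
  have h1 := hu.first_moment_le hr hr0 hm.le N
  have h2 : (a : ℝ) * ∑ k ∈ Finset.Ico a (N + 1), u k ≤
      ∑ k ∈ Finset.range (N + 1), (k : ℝ) * u k := by
    rw [Finset.mul_sum]
    calc ∑ k ∈ Finset.Ico a (N + 1), (a : ℝ) * u k
        ≤ ∑ k ∈ Finset.Ico a (N + 1), (k : ℝ) * u k := by
          refine Finset.sum_le_sum fun k hk => mul_le_mul_of_nonneg_right ?_ (hu.nonneg k)
          exact_mod_cast (Finset.mem_Ico.1 hk).1
      _ ≤ _ := by
          rw [Finset.range_eq_Ico]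
          refine Finset.sum_le_sum_of_subset_of_nonneg
            (Finset.Ico_subset_Ico (Nat.zero_le a) le_rfl) fun k _ _ => ?_
          exact mul_nonneg (by positivity) (hu.nonneg k)
  rw [le_div_iff₀ (by positivity)]
  calc (∑ k ∈ Finset.Ico a (N + 1), u k) * (a * r m ^ 2)
      = r m ^ 2 * (a * ∑ k ∈ Finset.Ico a (N + 1), u k) := by ring
    _ ≤ _ := (mul_le_mul_of_nonneg_left h2 (by positivity)).trans h1

/-- Before `a`, bound the tail by `r (n - a)` and the mass by `1 / r m`; from `a` on, bound the tail
by 1 and use the first moment. -/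
lemma IsTruncatedRenewal.conv_le (hu : IsTruncatedRenewal r m u) (hr : Antitone r)
    (hr0 : r 0 = 1) (hm : 0 < r m) {a n : ℕ} (ha : 0 < a) (han : a ≤ n) (hn : 0 ≤ r (n - a)) :
    ∑ k ∈ Finset.range (n + 1), u k * r (n - k) ≤ r (n - a) / r m + m / (a * r m ^ 2) := by
  rw [← Finset.sum_range_add_sum_Ico _ (show a ≤ n + 1 by omega)]
  refine add_le_add ?_ ?_
  · obtain ⟨a, rfl⟩ := Nat.exists_eq_add_of_le' ha
    have h1 := hu.mul_sum_le hr hr0 a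
    rw [le_div_iff₀ hm]
    calc (∑ k ∈ Finset.range (a + 1), u k * r (n - k)) * r m
        ≤ (∑ k ∈ Finset.range (a + 1), u k * r (n - (a + 1))) * r m := by
          refine mul_le_mul_of_nonneg_right (Finset.sum_le_sum fun k hk => ?_) hm.le
          rw [Finset.mem_range] at hk
          exact mul_le_mul_of_nonneg_left (hr (by omega)) (hu.nonneg k)
      _ = r (n - (a + 1)) * (r m * ∑ k ∈ Finset.range (a + 1), u k) := by
          rw [← Finset.sum_mul]
          ring
      _ ≤ r (n - (a + 1)) := mul_le_of_le_one_right hn h1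
  · refine le_trans (Finset.sum_le_sum fun k _ => ?_) (hu.sum_Ico_le hr hr0 hm ha n)
    exact mul_le_of_le_one_right (hu.nonneg k) (hr0 ▸ hr (Nat.zero_le _))

/-- Every tail factor is at least `r n`, and the mass is nearly `1 / r m` because little of it lies
in the last `m` times. -/
lemma IsTruncatedRenewal.le_conv (hu : IsTruncatedRenewal r m u) (hr : Antitone r)
    (hr0 : r 0 = 1) (hm : 0 < r m) {n : ℕ} (hn : 0 ≤ r n) (hmn : m < n + 1) :
    r n / r m * (1 - m / ((n + 1 - m : ℕ) * r m ^ 2)) ≤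
      ∑ k ∈ Finset.range (n + 1), u k * r (n - k) := by
  have h1 := hu.le_mul_sum hr hr0 (Nat.lt_succ_iff.1 hmn)
  have h2 := hu.sum_Ico_le hr hr0 hm (show 0 < n + 1 - m by omega) n
  have h3 := Finset.sum_range_add_sum_Ico u (show n + 1 - m ≤ n + 1 by omega)
  have hm1 : r m ≤ 1 := hr0 ▸ hr (Nat.zero_le m)
  set W := ∑ k ∈ Finset.range (n + 1), u k
  set e := (m : ℝ) / ((n + 1 - m : ℕ) * r m ^ 2)
  have he : 0 ≤ ∑ k ∈ Finset.Ico (n + 1 - m) (n + 1), u k :=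
    Finset.sum_nonneg fun k _ => hu.nonneg k
  have h4 : 1 - e ≤ r m * W := by nlinarith
  calc r n / r m * (1 - e) ≤ r n / r m * (r m * W) :=
        mul_le_mul_of_nonneg_left h4 (by positivity)
    _ = W * r n := by field_simp
    _ ≤ _ := by
        rw [Finset.sum_mul]
        exact Finset.sum_le_sum fun k _ =>
          mul_le_mul_of_nonneg_left (hr (Nat.sub_le n k)) (hu.nonneg k)

end Renewal


/-! ### Asymptotics of the return probabilities and logarithmic scales -/

/-- The probability `(4⁻ᵏ (2k choose k))²` that the planar walk is at the origin at time `2k`. -/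
noncomputable def evenReturnProb (k : ℕ) : ℝ := ((Nat.centralBinom k : ℝ) / 4 ^ k) ^ 2

lemma evenReturnProb_pos (k : ℕ) : 0 < evenReturnProb k := by
  have : (0 : ℝ) < Nat.centralBinom k := by exact_mod_cast Nat.centralBinom_pos k
  rw [evenReturnProb]
  positivity

lemma evenReturnProb_zero : evenReturnProb 0 = 1 := by simp [evenReturnProb]

lemma evenReturnProb_succ (k : ℕ) :
    evenReturnProb (k + 1) = evenReturnProb k * ((2 * k + 1) / (2 * k + 2)) ^ 2 := by
  have h : ((k : ℝ) + 1) * Nat.centralBinom (k + 1) = 2 * (2 * k + 1) * Nat.centralBinom k := by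
    exact_mod_cast Nat.succ_mul_centralBinom_succ k
  rw [evenReturnProb, evenReturnProb, ← mul_pow]
  congr 1
  rw [pow_succ]
  field_simp
  linear_combination 2 * h

/-- The left side decreases in `k`, since `(2k + 1)(2k + 3) ≤ (2k + 2)²`. -/
lemma mul_evenReturnProb_le (k : ℕ) : (2 * k + 1) * evenReturnProb k ≤ 1 := by
  induction k with
  | zero => simp [evenReturnProb_zero]
  | succ k ih =>
    refine le_trans ?_ ih
    rw [evenReturnProb_succ]
    have h : (2 * ((k + 1 : ℕ) : ℝ) + 1) * ((2 * k + 1) / (2 * k + 2)) ^ 2 ≤ 2 * k + 1 := by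
      rw [div_pow, ← mul_div_assoc, div_le_iff₀ (by positivity)]
      push_cast
      nlinarith [show (0 : ℝ) ≤ k by positivity]
    calc _ = (2 * ((k + 1 : ℕ) : ℝ) + 1) * ((2 * k + 1) / (2 * k + 2)) ^ 2 * evenReturnProb k := by
          ring
      _ ≤ _ := mul_le_mul_of_nonneg_right h (evenReturnProb_pos k).le

lemma monotone_mul_evenReturnProb : Monotone fun k : ℕ => (k : ℝ) * evenReturnProb k := by
  refine monotone_nat_of_le_succ fun k => ?_
  rw [evenReturnProb_succ]
  have h : (k : ℝ) ≤ ((k + 1 : ℕ) : ℝ) * ((2 * k + 1) / (2 * k + 2)) ^ 2 := by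
    rw [div_pow, ← mul_div_assoc, le_div_iff₀ (by positivity)]
    push_cast
    nlinarith [show (0 : ℝ) ≤ k by positivity]
  calc _ ≤ ((k + 1 : ℕ) : ℝ) * ((2 * k + 1) / (2 * k + 2)) ^ 2 * evenReturnProb k :=
        mul_le_mul_of_nonneg_right h (evenReturnProb_pos k).le
    _ = _ := by ring

/-- Monotonicity and boundedness replace Stirling's formula: only the positivity of the limit
matters. -/
lemma exists_tendsto_mul_evenReturnProb :
    ∃ c : ℝ, 0 < c ∧ Tendsto (fun k : ℕ => (k : ℝ) * evenReturnProb k) atTop (𝓝 c) := by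
  have hb : BddAbove (Set.range fun k : ℕ => (k : ℝ) * evenReturnProb k) := by
    refine ⟨1, ?_⟩
    rintro _ ⟨k, rfl⟩
    have := mul_evenReturnProb_le k
    have h0 := (evenReturnProb_pos k).le
    have hk : (0 : ℝ) ≤ k * evenReturnProb k := by positivity
    dsimp only
    nlinarith
  refine ⟨_, ?_, tendsto_atTop_ciSup monotone_mul_evenReturnProb hb⟩
  refine lt_of_lt_of_le ?_ (le_ciSup hb 1)
  simpa using evenReturnProb_pos 1

lemma tendsto_log_natCast_atTop : Tendsto (fun n : ℕ => Real.log n) atTop atTop :=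
  Real.tendsto_log_atTop.comp tendsto_natCast_atTop_atTop

lemma tendsto_harmonic_div_log :
    Tendsto (fun n : ℕ => (harmonic n : ℝ) / Real.log n) atTop (𝓝 1) := by
  have h1 := Real.tendsto_harmonic_sub_log.div_atTop tendsto_log_natCast_atTop
  have h2 := h1.add_const 1
  rw [zero_add] at h2
  refine h2.congr' ?_
  filter_upwards [tendsto_log_natCast_atTop.eventually_gt_atTop 0] with n hn
  field_simp
  ring

lemma tendsto_sum_evenReturnProb_div_log {c : ℝ}
    (hc : Tendsto (fun k : ℕ => (k : ℝ) * evenReturnProb k) atTop (𝓝 c)) :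
    Tendsto (fun N : ℕ => (∑ k ∈ Finset.range N, evenReturnProb (k + 1)) / Real.log N) atTop
      (𝓝 c) := by
  have hH : ∀ N : ℕ, ∑ k ∈ Finset.range N, ((k : ℝ) + 1)⁻¹ = harmonic N := by
    intro N
    simp [harmonic]
  have hlim : Tendsto (fun N : ℕ => (harmonic N : ℝ)) atTop atTop := by
    have h := tendsto_harmonic_div_log.pos_mul_atTop one_pos tendsto_log_natCast_atTop
    refine h.congr' ?_
    filter_upwards [tendsto_log_natCast_atTop.eventually_gt_atTop 0] with n hn
    field_simp
  have h1 : (fun k : ℕ => evenReturnProb (k + 1) - c * ((k : ℝ) + 1)⁻¹) =o[atTop]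
      fun k : ℕ => ((k : ℝ) + 1)⁻¹ := by
    rw [Asymptotics.isLittleO_iff_tendsto' (Eventually.of_forall fun k hk => by
      have : (0 : ℝ) < ((k : ℝ) + 1)⁻¹ := by positivity
      exact absurd hk this.ne')]
    have h2 := ((tendsto_add_atTop_iff_nat 1).2 hc).sub_const c
    rw [sub_self] at h2
    refine h2.congr fun k => ?_
    push_cast
    field_simp
  have h2 := h1.sum_range (fun k => by positivity) (by simpa only [hH] using hlim)
  simp only [Finset.sum_sub_distrib, ← Finset.mul_sum, hH] at h2
  have h3 := h2.tendsto_div_nhds_zero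
  have h4 := (h3.add_const c).mul tendsto_harmonic_div_log
  rw [zero_add, mul_one] at h4
  refine h4.congr' ?_
  filter_upwards [hlim.eventually_gt_atTop 0,
    tendsto_log_natCast_atTop.eventually_gt_atTop 0] with n hn hn'
  field_simp
  ring

/-- If `b n` grows like `n ^ x`, then `log (b n) ∼ x log n`. -/
lemma tendsto_log_div_log {b : ℕ → ℕ} {x β : ℝ} (hβ : 0 < β)
    (hb : Tendsto (fun n : ℕ => (b n : ℝ) / (n : ℝ) ^ x) atTop (𝓝 β)) :
    Tendsto (fun n : ℕ => Real.log (b n) / Real.log n) atTop (𝓝 x) := by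
  have h1 := ((hb.log hβ.ne').div_atTop tendsto_log_natCast_atTop).add_const x
  rw [zero_add] at h1
  refine h1.congr' ?_
  filter_upwards [tendsto_log_natCast_atTop.eventually_gt_atTop 0, eventually_gt_atTop 0,
    hb.eventually_const_lt hβ] with n hn hn0 hbn
  have hn0' : (0 : ℝ) < n := by exact_mod_cast hn0
  have hx : (0 : ℝ) < (n : ℝ) ^ x := Real.rpow_pos_of_pos hn0' x
  have hb0 : (b n : ℝ) ≠ 0 := by
    rintro h
    rw [h, zero_div] at hbn
    exact lt_irrefl _ hbn
  rw [Real.log_div hb0 hx.ne', Real.log_rpow hn0']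
  field_simp
  ring

lemma tendsto_half_div : Tendsto (fun n : ℕ => ((n / 2 : ℕ) : ℝ) / n) atTop (𝓝 (1 / 2)) := by
  have h := (tendsto_nat_floor_mul_div_atTop (R := ℝ) (a := 1 / 2) (by norm_num)).comp
    tendsto_natCast_atTop_atTop
  refine h.congr fun n => ?_
  have := Nat.floor_div_eq_div (K := ℝ) n 2
  simp only [Function.comp_apply]
  rw [← this]
  congr 3
  push_cast
  ring

lemma tendsto_half_atTop : Tendsto (fun n : ℕ => n / 2) atTop atTop :=
  Nat.tendsto_div_const_atTop two_ne_zero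

lemma tendsto_log_half_div_log :
    Tendsto (fun n : ℕ => Real.log ((n / 2 : ℕ) : ℝ) / Real.log n) atTop (𝓝 1) := by
  refine tendsto_log_div_log (b := fun n => n / 2) (β := 1 / 2) (by norm_num) ?_
  simpa only [Real.rpow_one] using tendsto_half_div

/-! ### Tail of the first return time -/

section Tail

variable {r p : ℕ → ℝ}

lemma sum_returnProb_eq (hp0 : ∀ k, p (2 * k) = evenReturnProb k) (hp1 : ∀ k, p (2 * k + 1) = 0)
    (n : ℕ) : ∑ k ∈ Finset.range (n + 1), p k =
      1 + ∑ k ∈ Finset.range (n / 2), evenReturnProb (k + 1) := by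
  induction n with
  | zero => simpa [evenReturnProb_zero] using hp0 0
  | succ n ih =>
    rw [Finset.sum_range_succ, ih]
    obtain ⟨k, rfl | rfl⟩ := Nat.even_or_odd' n
    · rw [hp1, show (2 * k + 1) / 2 = k by omega, show 2 * k / 2 = k by omega, add_zero]
    · rw [show 2 * k + 1 + 1 = 2 * (k + 1) by ring, hp0, show (2 * k + 1) / 2 = k by omega,
        show 2 * (k + 1) / 2 = k + 1 by omega, Finset.sum_range_succ]
      ring

lemma returnProb_nonneg (hp0 : ∀ k, p (2 * k) = evenReturnProb k)
    (hp1 : ∀ k, p (2 * k + 1) = 0) (n : ℕ) : 0 ≤ p n := by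
  obtain ⟨k, rfl | rfl⟩ := Nat.even_or_odd' n
  · rw [hp0]
    exact (evenReturnProb_pos k).le
  · rw [hp1]

lemma returnProb_le (hp0 : ∀ k, p (2 * k) = evenReturnProb k)
    (hp1 : ∀ k, p (2 * k + 1) = 0) (n : ℕ) : p n ≤ 1 / (n + 1) := by
  obtain ⟨k, rfl | rfl⟩ := Nat.even_or_odd' n
  · rw [hp0, le_div_iff₀ (by positivity)]
    have := mul_evenReturnProb_le k
    push_cast
    linarith
  · rw [hp1]
    positivity

/-- The tail of the first return time decays like the inverse of the Green function. -/
lemma tendsto_tail_mul_green (hr : Antitone r) (hr0 : ∀ n, 0 ≤ r n)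
    (hp0 : ∀ k, p (2 * k) = evenReturnProb k) (hp1 : ∀ k, p (2 * k + 1) = 0)
    (hpr : ∀ n, ∑ k ∈ Finset.range (n + 1), p k * r (n - k) = 1)
    (hG : Tendsto (fun n => ∑ k ∈ Finset.range (n + 1), p k) atTop atTop) :
    Tendsto (fun n => r n * ∑ k ∈ Finset.range (n + 1), p k) atTop (𝓝 1) := by
  have hp := returnProb_nonneg hp0 hp1
  have hle : ∀ n, r n * ∑ k ∈ Finset.range (n + 1), p k ≤ 1 := by
    intro n
    rw [← hpr n, Finset.mul_sum]
    refine Finset.sum_le_sum fun k _ => ?_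
    rw [mul_comm]
    exact mul_le_mul_of_nonneg_left (hr (Nat.sub_le n k)) (hp k)
  have hr_lim : Tendsto r atTop (𝓝 0) := by
    refine tendsto_of_tendsto_of_tendsto_of_le_of_le' tendsto_const_nhds
      (tendsto_inv_atTop_zero.comp hG) (Eventually.of_forall hr0) ?_
    filter_upwards [hG.eventually_gt_atTop 0] with n hn
    rw [Function.comp_apply, ← one_div, le_div_iff₀ hn]
    exact hle n
  have hces := hr_lim.cesaro
  -- The convolution identity at time `2 * n`, split after `k = n`: early terms have tail at most `r
  -- n`, late ones have `p k ≤ 1 / n` and leave a Cesàro mean of `r`, which vanishes.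
  have hge : ∀ n : ℕ, 1 - (n : ℝ)⁻¹ * ∑ j ∈ Finset.range n, r j ≤
      r n * ∑ k ∈ Finset.range (n + 1), p k := by
    intro n
    have h := hpr (2 * n)
    rw [show 2 * n + 1 = (n + 1) + n by ring, Finset.sum_range_add] at h
    have h1 : ∑ k ∈ Finset.range (n + 1), p k * r (2 * n - k) ≤
        r n * ∑ k ∈ Finset.range (n + 1), p k := by
      rw [Finset.mul_sum]
      refine Finset.sum_le_sum fun k hk => ?_
      rw [Finset.mem_range] at hk
      rw [mul_comm (r n)]
      exact mul_le_mul_of_nonneg_left (hr (by omega)) (hp k)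
    have h2 : ∑ j ∈ Finset.range n, p (n + 1 + j) * r (2 * n - (n + 1 + j)) ≤
        (n : ℝ)⁻¹ * ∑ j ∈ Finset.range n, r j := by
      rw [Finset.mul_sum, ← Finset.sum_range_reflect (fun j => (n : ℝ)⁻¹ * r j)]
      refine Finset.sum_le_sum fun j hj => ?_
      rw [Finset.mem_range] at hj
      rw [show 2 * n - (n + 1 + j) = n - 1 - j by omega]
      refine mul_le_mul_of_nonneg_right ?_ (hr0 _)
      refine (returnProb_le hp0 hp1 _).trans ?_
      rw [← one_div]
      have : (0 : ℝ) < n := by exact_mod_cast (by omega : 0 < n)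
      refine one_div_le_one_div_of_le this ?_
      push_cast
      have : (0 : ℝ) ≤ j := by positivity
      linarith
    linarith
  refine tendsto_of_tendsto_of_tendsto_of_le_of_le ?_ tendsto_const_nhds hge hle
  simpa using hces.const_sub 1

lemma exists_tendsto_tail_mul_log (hr : Antitone r) (hr0 : ∀ n, 0 ≤ r n)
    (hp0 : ∀ k, p (2 * k) = evenReturnProb k) (hp1 : ∀ k, p (2 * k + 1) = 0)
    (hpr : ∀ n, ∑ k ∈ Finset.range (n + 1), p k * r (n - k) = 1) :
    ∃ C : ℝ, 0 < C ∧ Tendsto (fun n : ℕ => r n * Real.log n) atTop (𝓝 C) := by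
  obtain ⟨c, hc0, hc⟩ := exists_tendsto_mul_evenReturnProb
  have h1 := (tendsto_sum_evenReturnProb_div_log hc).comp tendsto_half_atTop
  have h2 : Tendsto (fun n : ℕ => (∑ k ∈ Finset.range (n + 1), p k) / Real.log n) atTop (𝓝 c) := by
    have h3 := (h1.mul tendsto_log_half_div_log).add
      (tendsto_const_nhds (x := (1 : ℝ)).div_atTop tendsto_log_natCast_atTop)
    rw [mul_one, add_zero] at h3
    refine h3.congr' ?_
    filter_upwards [tendsto_log_natCast_atTop.eventually_gt_atTop 0,
      (tendsto_log_natCast_atTop.comp tendsto_half_atTop).eventually_gt_atTop 0] with n hn hn'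
    rw [sum_returnProb_eq hp0 hp1]
    simp only [Function.comp_apply] at hn' ⊢
    field_simp
    ring
  have hG : Tendsto (fun n => ∑ k ∈ Finset.range (n + 1), p k) atTop atTop := by
    refine (h2.pos_mul_atTop hc0 tendsto_log_natCast_atTop).congr' ?_
    filter_upwards [tendsto_log_natCast_atTop.eventually_gt_atTop 0] with n hn
    field_simp
  refine ⟨1 / c, by positivity, ?_⟩
  refine ((tendsto_tail_mul_green hr hr0 hp0 hp1 hpr hG).div h2 hc0.ne').congr' ?_
  filter_upwards [tendsto_log_natCast_atTop.eventually_gt_atTop 0,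
    hG.eventually_gt_atTop 0] with n hn hn'
  simp only [Pi.div_apply]
  field_simp

end Tail

/-! ### The limit at truncation level `n ^ x` -/

section Truncation

variable {r : ℕ → ℝ} {C x : ℝ}

lemma tendsto_floor_rpow_div (hx : 0 < x) :
    Tendsto (fun n : ℕ => (⌊(n : ℝ) ^ x⌋₊ : ℝ) / (n : ℝ) ^ x) atTop (𝓝 1) :=
  (tendsto_nat_floor_div_atTop (R := ℝ)).comp
    ((tendsto_rpow_atTop hx).comp tendsto_natCast_atTop_atTop)

lemma tendsto_floor_rpow_atTop (hx : 0 < x) :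
    Tendsto (fun n : ℕ => ⌊(n : ℝ) ^ x⌋₊) atTop atTop :=
  tendsto_nat_floor_atTop.comp ((tendsto_rpow_atTop hx).comp tendsto_natCast_atTop_atTop)

lemma tendsto_rpow_sub_one_mul_log_sq (hx : x < 1) :
    Tendsto (fun n : ℕ => (n : ℝ) ^ (x - 1) * Real.log n ^ 2) atTop (𝓝 0) := by
  have h := (isLittleO_log_rpow_rpow_atTop 2 (sub_pos.2 hx)).tendsto_div_nhds_zero.comp
    tendsto_natCast_atTop_atTop
  refine h.congr fun n => ?_
  simp only [Function.comp_apply]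
  rw [div_eq_mul_inv, ← Real.rpow_neg (by positivity), neg_sub, mul_comm, Real.rpow_two]

lemma tendsto_tail_div_tail (hC : 0 < C)
    (hr : Tendsto (fun n : ℕ => r n * Real.log n) atTop (𝓝 C)) {b d : ℕ → ℕ} {y z : ℝ}
    (hb : Tendsto b atTop atTop) (hd : Tendsto d atTop atTop)
    (hby : Tendsto (fun n : ℕ => Real.log (b n) / Real.log n) atTop (𝓝 y))
    (hdz : Tendsto (fun n : ℕ => Real.log (d n) / Real.log n) atTop (𝓝 z)) (hy : y ≠ 0) :
    Tendsto (fun n => r (b n) / r (d n)) atTop (𝓝 (z / y)) := by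
  have h := ((hr.comp hb).div (hr.comp hd) hC.ne').mul (hdz.div hby hy)
  rw [div_self hC.ne', one_mul] at h
  refine h.congr' ?_
  filter_upwards [tendsto_log_natCast_atTop.eventually_gt_atTop 0,
    (tendsto_log_natCast_atTop.comp hb).eventually_gt_atTop 0,
    (tendsto_log_natCast_atTop.comp hd).eventually_gt_atTop 0] with n hn hbn hdn
  simp only [Pi.div_apply, Function.comp_apply] at hbn hdn ⊢
  field_simp

/-- Up to constants the quotient is `n ^ (x - 1) * log n ^ 2`. -/
lemma tendsto_error (hC : 0 < C) (hr : Tendsto (fun n : ℕ => r n * Real.log n) atTop (𝓝 C))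
    (hx0 : 0 < x) (hx1 : x < 1) {b : ℕ → ℕ} {β : ℝ} (hβ : 0 < β)
    (hb : Tendsto (fun n : ℕ => (b n : ℝ) / n) atTop (𝓝 β)) :
    Tendsto (fun n : ℕ => (⌊(n : ℝ) ^ x⌋₊ : ℝ) / (b n * r ⌊(n : ℝ) ^ x⌋₊ ^ 2)) atTop (𝓝 0) := by
  have h1 := tendsto_floor_rpow_div hx0
  have h2 := tendsto_log_div_log one_pos h1
  have h3 := (hr.comp (tendsto_floor_rpow_atTop hx0)).pow 2
  have h4 := ((((h1.mul (h2.pow 2)).div hb hβ.ne').div h3 (by positivity)).mul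
    (tendsto_rpow_sub_one_mul_log_sq hx1))
  rw [mul_zero] at h4
  refine h4.congr' ?_
  filter_upwards [tendsto_log_natCast_atTop.eventually_gt_atTop 0, eventually_gt_atTop 0,
    (tendsto_log_natCast_atTop.comp (tendsto_floor_rpow_atTop hx0)).eventually_gt_atTop 0]
    with n hn hn0 hdn
  have hn0' : (0 : ℝ) < n := by exact_mod_cast hn0
  simp only [Pi.div_apply, Function.comp_apply] at hdn ⊢
  have hx : (0 : ℝ) < (n : ℝ) ^ x := Real.rpow_pos_of_pos hn0' x
  rw [Real.rpow_sub hn0', Real.rpow_one]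
  field_simp

/-- The mass function of the longest completed renewal interval, at level `n ^ x`. -/
lemma tendsto_conv_truncatedRenewal (hr : Antitone r) (hr1 : r 0 = 1) (hC : 0 < C)
    (hrC : Tendsto (fun n : ℕ => r n * Real.log n) atTop (𝓝 C)) {u : ℕ → ℕ → ℝ}
    (hu : ∀ m, IsTruncatedRenewal r m (u m)) (hx0 : 0 < x) (hx1 : x < 1) :
    Tendsto (fun n : ℕ => ∑ k ∈ Finset.range (n + 1), u ⌊(n : ℝ) ^ x⌋₊ k * r (n - k)) atTop
      (𝓝 x) := by
  have hpos : ∀ᶠ n in atTop, 0 < r n := by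
    filter_upwards [hrC.eventually_const_lt hC,
      tendsto_log_natCast_atTop.eventually_gt_atTop 0] with n hn hn'
    exact pos_of_mul_pos_left hn hn'.le
  have hm := tendsto_floor_rpow_atTop hx0
  have hmx := tendsto_log_div_log one_pos (tendsto_floor_rpow_div hx0)
  have hlog1 : Tendsto (fun n : ℕ => Real.log n / Real.log n) atTop (𝓝 1) := by
    refine tendsto_log_div_log (b := fun n => n) one_pos ?_
    refine tendsto_const_nhds.congr' ?_
    filter_upwards [eventually_gt_atTop 0] with n hn
    rw [Real.rpow_one, div_self (by positivity)]
  have hmn : Tendsto (fun n : ℕ => (⌊(n : ℝ) ^ x⌋₊ : ℝ) / n) atTop (𝓝 0) := by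
    have h := (tendsto_floor_rpow_div hx0).mul
      ((tendsto_rpow_neg_atTop (sub_pos.2 hx1)).comp tendsto_natCast_atTop_atTop)
    rw [mul_zero] at h
    refine h.congr' ?_
    filter_upwards [eventually_gt_atTop 0] with n hn0
    have hn0' : (0 : ℝ) < n := by exact_mod_cast hn0
    have hx : (0 : ℝ) < (n : ℝ) ^ x := Real.rpow_pos_of_pos hn0' x
    simp only [Function.comp_apply]
    rw [neg_sub, Real.rpow_sub hn0', Real.rpow_one]
    field_simp
  have hlt : ∀ᶠ n : ℕ in atTop, ⌊(n : ℝ) ^ x⌋₊ < n := by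
    filter_upwards [hmn.eventually_lt_const one_pos, eventually_gt_atTop 0] with n hn hn0
    rw [div_lt_one (by exact_mod_cast hn0)] at hn
    exact_mod_cast hn
  have hb1 : Tendsto (fun n : ℕ => ((n + 1 - ⌊(n : ℝ) ^ x⌋₊ : ℕ) : ℝ) / n) atTop (𝓝 1) := by
    have h := (tendsto_const_nhds (x := (1 : ℝ))).add
      ((tendsto_const_nhds (x := (1 : ℝ))).div_atTop tendsto_natCast_atTop_atTop)
    have h := h.sub hmn
    rw [add_zero, sub_zero] at h
    refine h.congr' ?_
    filter_upwards [hlt, eventually_gt_atTop 0] with n hn hn0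
    rw [Nat.cast_sub (by omega)]
    have hn0' : (0 : ℝ) < n := by exact_mod_cast hn0
    push_cast
    field_simp
  have hb2 : Tendsto (fun n : ℕ => ((n - n / 2 : ℕ) : ℝ) / n) atTop (𝓝 (1 / 2)) := by
    have h := (tendsto_const_nhds (x := (1 : ℝ))).sub tendsto_half_div
    norm_num at h
    refine (by simpa using h : Tendsto _ _ _).congr' ?_
    filter_upwards [eventually_gt_atTop 0] with n hn0
    rw [Nat.cast_sub (Nat.div_le_self n 2)]
    have hn0' : (0 : ℝ) < n := by exact_mod_cast hn0
    field_simp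
  have hlow := (tendsto_tail_div_tail hC hrC tendsto_id hm hlog1 hmx one_ne_zero).mul
    ((tendsto_error hC hrC hx0 hx1 one_pos hb1).const_sub 1)
  -- The cut is at `a = n - n / 2`: it is of order `n`, and the remaining tail `r (n / 2)` is
  -- asymptotic to `r n` as the logarithm does not see the factor 2.
  have hup := (tendsto_tail_div_tail hC hrC tendsto_half_atTop hm tendsto_log_half_div_log hmx
    one_ne_zero).add (tendsto_error hC hrC hx0 hx1 (by norm_num) hb2)
  simp only [div_one, sub_zero, mul_one, add_zero] at hlow hup
  refine tendsto_of_tendsto_of_tendsto_of_le_of_le' hlow hup ?_ ?_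
  · filter_upwards [hpos, hm.eventually hpos, hlt] with n hn hmn hmn'
    exact (hu _).le_conv (n := n) hr hr1 hmn hn.le (by omega)
  · filter_upwards [tendsto_half_atTop.eventually hpos, hm.eventually hpos,
      eventually_gt_atTop 0] with n hn hmn hn0
    have e : n - (n - n / 2) = n / 2 := by omega
    have := (hu ⌊(n : ℝ) ^ x⌋₊).conv_le hr hr1 hmn (show 0 < n - n / 2 by omega)
      (Nat.sub_le n (n / 2)) (by rw [e]; exact hn.le)
    rwa [e] at this

end Truncation


/-! ### The one-dimensional walk -/

section Binomial

/-- The law of the one-dimensional simple random walk at time `n`. -/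
noncomputable def lineWalkProb : ℕ → ℤ → ℝ
  | 0, j => if j = 0 then 1 else 0
  | n + 1, j => (lineWalkProb n (j - 1) + lineWalkProb n (j + 1)) / 2

lemma lineWalkProb_of_lt (n : ℕ) (j : ℤ) (h : j < -n) : lineWalkProb n j = 0 := by
  induction n generalizing j with
  | zero => rw [lineWalkProb, if_neg (by simp at h; omega)]
  | succ n ih =>
    push_cast at h
    rw [lineWalkProb, ih _ (by omega), ih _ (by omega)]
    norm_num

lemma lineWalkProb_of_odd (n : ℕ) (j : ℤ) (h : Odd (n + j)) : lineWalkProb n j = 0 := by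
  induction n generalizing j with
  | zero =>
    rw [lineWalkProb, if_neg]
    rintro rfl
    simp at h
  | succ n ih =>
    push_cast at h
    rw [lineWalkProb, ih (j - 1) (by grind), ih (j + 1) (by grind)]
    norm_num

lemma lineWalkProb_eq (n k : ℕ) : lineWalkProb n (2 * k - n) = n.choose k / 2 ^ n := by
  induction n generalizing k with
  | zero =>
    rcases k with _ | k
    · simp [lineWalkProb]
    · rw [lineWalkProb, if_neg (by push_cast; omega)]
      simp
  | succ n ih =>
    have h1 : lineWalkProb n (2 * k - (n + 1 : ℕ) + 1) = n.choose k / 2 ^ n := by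
      rw [← ih]
      congr 1
      push_cast
      ring
    rw [lineWalkProb, h1, pow_succ]
    rcases k with _ | k
    · rw [lineWalkProb_of_lt _ _ (by push_cast; omega)]
      simp
      field_simp
    · have h2 : lineWalkProb n (2 * (k + 1 : ℕ) - (n + 1 : ℕ) - 1) = n.choose k / 2 ^ n := by
        rw [← ih]
        congr 1
        push_cast
        ring
      rw [h2, Nat.choose_succ_succ]
      push_cast
      field_simp

lemma lineWalkProb_sq_even (k : ℕ) : lineWalkProb (2 * k) 0 ^ 2 = evenReturnProb k := by
  have h := lineWalkProb_eq (2 * k) k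
  rw [show (2 * (k : ℤ) - (2 * k : ℕ)) = 0 by push_cast; ring] at h
  rw [h, evenReturnProb, Nat.centralBinom_eq_two_mul_choose, pow_mul]
  norm_num

lemma lineWalkProb_odd (k : ℕ) : lineWalkProb (2 * k + 1) 0 = 0 :=
  lineWalkProb_of_odd _ _ (by simp)

end Binomial

/-! ### The canonical space of steps and the Markov property -/

section Law

open scoped ENNReal

/-- The law of a step of the planar simple random walk. -/
noncomputable def stepLaw : Measure (ℤ × ℤ) :=
  (4⁻¹ : ℝ≥0∞) • (Measure.dirac (0, 1) + Measure.dirac (0, -1) + Measure.dirac (1, 0) +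
    Measure.dirac (-1, 0))

instance : IsProbabilityMeasure stepLaw where
  measure_univ := by
    simp only [stepLaw, Measure.smul_apply, Measure.add_apply, measure_univ, smul_eq_mul]
    norm_num
    exact ENNReal.inv_mul_cancel (by norm_num) (by norm_num)

/-- The law of the sequence of steps of the planar simple random walk. -/
noncomputable def stepsLaw : Measure (ℕ → ℤ × ℤ) := Measure.infinitePi fun _ => stepLaw

instance : IsProbabilityMeasure stepsLaw := by
  unfold stepsLaw
  infer_instance

lemma map_step_eq {Ω : Type*} [MeasurableSpace Ω] {P : Measure Ω} [IsProbabilityMeasure P]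
    {ξ : ℕ → Ω → ℤ × ℤ} (hξ : IsSimpleStep P ξ) (i : ℕ) : P.map (ξ i) = stepLaw := by
  have hm := hξ.measurable i
  have : IsProbabilityMeasure (P.map (ξ i)) := Measure.isProbabilityMeasure_map hm.aemeasurable
  have hv : ∀ z, P.map (ξ i) {z} = P {ω | ξ i ω = z} := fun z =>
    Measure.map_apply hm (measurableSet_singleton z)
  have h4 : ∀ z ∈ ({(0, 1), (0, -1), (1, 0), (-1, 0)} : Finset (ℤ × ℤ)),
      P.map (ξ i) {z} = 1 / 4 := by
    intro z hz
    simp only [Finset.mem_insert, Finset.mem_singleton] at hz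
    rcases hz with rfl | rfl | rfl | rfl
    · rw [hv, hξ.up]
    · rw [hv, hξ.down]
    · rw [hv, hξ.right]
    · rw [hv, hξ.left]
  have hF : P.map (ξ i) ({(0, 1), (0, -1), (1, 0), (-1, 0)} : Finset (ℤ × ℤ)) = 1 := by
    rw [← sum_measure_singleton, Finset.sum_congr rfl h4]
    rw [Finset.sum_const, show Finset.card _ = 4 from rfl, nsmul_eq_mul]
    exact ENNReal.mul_div_cancel (by norm_num) (by norm_num)
  refine Measure.ext_of_singleton fun z => ?_
  by_cases hz : z ∈ ({(0, 1), (0, -1), (1, 0), (-1, 0)} : Finset (ℤ × ℤ))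
  · rw [h4 z hz, stepLaw]
    simp only [Finset.mem_insert, Finset.mem_singleton] at hz
    rcases hz with rfl | rfl | rfl | rfl <;> simp
  · have h0 : P.map (ξ i) {z} = 0 := by
      refine measure_mono_null ?_ ((prob_compl_eq_zero_iff
        (Finset.measurableSet _)).2 hF)
      simpa using hz
    rw [h0, stepLaw]
    simp only [Finset.mem_insert, Finset.mem_singleton, not_or] at hz
    simp [Ne.symm hz.1, Ne.symm hz.2.1, Ne.symm hz.2.2.1, Ne.symm hz.2.2.2]

lemma map_steps_eq {Ω : Type*} [MeasurableSpace Ω] {P : Measure Ω} [IsProbabilityMeasure P]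
    {ξ : ℕ → Ω → ℤ × ℤ} (hξ : IsSimpleStep P ξ) : P.map (fun ω i => ξ i ω) = stepsLaw := by
  rw [hξ.indep.map_fun_eq_infinitePi_map hξ.measurable, stepsLaw]
  simp_rw [map_step_eq hξ]

/-- The event `A` is determined by the first `n` steps. -/
def DeterminedBy (n : ℕ) (A : Set (ℕ → ℤ × ℤ)) : Prop :=
  ∀ x y : ℕ → ℤ × ℤ, (∀ i < n, x i = y i) → x ∈ A → y ∈ A

lemma DeterminedBy.eq_preimage {n : ℕ} {A : Set (ℕ → ℤ × ℤ)} (hA : DeterminedBy n A) :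
    A = (fun x (i : Finset.range n) => x i) ⁻¹'
      ((fun x (i : Finset.range n) => x i) '' A) := by
  refine Set.Subset.antisymm (Set.subset_preimage_image _ _) ?_
  rintro y ⟨x, hx, hxy⟩
  exact hA x y (fun i hi => congr_fun hxy ⟨i, Finset.mem_range.2 hi⟩) hx

/-- The event is pulled back from finitely many coordinates, a countable space in which every set is
measurable. -/
lemma DeterminedBy.measurableSet {n : ℕ} {A : Set (ℕ → ℤ × ℤ)} (hA : DeterminedBy n A) :
    MeasurableSet A := by
  rw [hA.eq_preimage]
  exact measurableSet_preimage (by fun_prop) (Set.to_countable _).measurableSet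

/-- The sequence of steps after time `k`. -/
def shift (k : ℕ) (x : ℕ → ℤ × ℤ) : ℕ → ℤ × ℤ := fun j => x (k + j)

lemma measurable_shift (k : ℕ) : Measurable (shift k) :=
  measurable_pi_lambda _ fun j => measurable_pi_apply (k + j)

lemma map_shift (k : ℕ) : stepsLaw.map (shift k) = stepsLaw :=
  Measure.map_infinitePi_infinitePi_of_inj (P := fun _ : ℕ => stepLaw) (add_right_injective k)

lemma iIndepFun_steps : iIndepFun (fun (i : ℕ) (x : ℕ → ℤ × ℤ) => x i) stepsLaw :=
  iIndepFun_infinitePi (P := fun _ : ℕ => stepLaw) (X := fun _ z => z) fun _ => measurable_id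

/-- It suffices to test finitely many future steps `J`; translated by `k`, they use indices disjoint
from the past. -/
lemma indepFun_past_future (k : ℕ) :
    IndepFun (fun x (i : Finset.range k) => x i) (shift k) stepsLaw := by
  refine IndepFun.indepFun_process (by fun_prop) (fun j => measurable_pi_apply (k + j)) fun J => ?_
  have hd : Disjoint (Finset.range k) (J.map (addLeftEmbedding k)) := by
    rw [Finset.disjoint_left]
    intro i hi hj
    rw [Finset.mem_range] at hi
    obtain ⟨j, -, rfl⟩ := Finset.mem_map.1 hj
    simp at hi
  have h := iIndepFun_steps.indepFun_finset _ _ hd fun i => measurable_pi_apply i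
  exact h.comp measurable_id
    (ψ := fun y (j : J) => y ⟨k + j, Finset.mem_map.2 ⟨j, j.2, rfl⟩⟩) (by fun_prop)

/-- The Markov property of the walk at a fixed time. -/
lemma real_inter_shift {k : ℕ} {A B : Set (ℕ → ℤ × ℤ)} (hA : DeterminedBy k A)
    (hB : MeasurableSet B) :
    stepsLaw.real (A ∩ shift k ⁻¹' B) = stepsLaw.real A * stepsLaw.real B := by
  have h := (indepFun_past_future k).measure_inter_preimage_eq_mul
    ((fun x (i : Finset.range k) => x i) '' A) B (Set.to_countable _).measurableSet hB
  rw [← hA.eq_preimage, ← Measure.map_apply (measurable_shift k) hB, map_shift] at h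
  rw [Measure.real, h, ENNReal.toReal_mul]
  rfl

end Law

/-! ### Decomposition at the last zero -/

section Events

/-- The path with steps `x`. -/
def path (x : ℕ → ℤ × ℤ) (n : ℕ) : ℤ × ℤ := ∑ i ∈ Finset.range n, x i

lemma path_zero (x : ℕ → ℤ × ℤ) : path x 0 = 0 := rfl

lemma path_congr {x y : ℕ → ℤ × ℤ} {n k : ℕ} (h : ∀ i < n, x i = y i) (hk : k ≤ n) :
    path x k = path y k :=
  Finset.sum_congr rfl fun i hi => h i ((Finset.mem_range.1 hi).trans_le hk)

lemma path_add (x : ℕ → ℤ × ℤ) (k j : ℕ) : path x (k + j) = path x k + path (shift k x) j :=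
  Finset.sum_range_add _ _ _

/-- The path is at the origin at time `k` and has no gap longer than `m` before. -/
def renewalEvent (m k : ℕ) : Set (ℕ → ℤ × ℤ) := {x | path x k = 0 ∧ GapsLE (path x) m k}

/-- The path does not return to the origin up to time `n`. -/
def noReturn (n : ℕ) : Set (ℕ → ℤ × ℤ) := {x | ∀ c, 0 < c → c ≤ n → path x c ≠ 0}

lemma determinedBy_path (n : ℕ) (z : ℤ × ℤ) : DeterminedBy n {x | path x n = z} := by
  intro x y h hx
  rwa [Set.mem_ofPred_eq, ← path_congr h le_rfl]

lemma determinedBy_gapsLE (m n : ℕ) : DeterminedBy n {x | GapsLE (path x) m n} := by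
  intro x y h hx a b hab hb ha0 hb0 hc
  refine hx a b hab hb ?_ ?_ fun c h1 h2 => ?_
  · rwa [path_congr h (by omega)]
  · rwa [path_congr h hb]
  · rw [path_congr h (by omega)]
    exact hc c h1 h2

lemma determinedBy_renewalEvent (m k : ℕ) : DeterminedBy k (renewalEvent m k) :=
  fun x y h hx => ⟨determinedBy_path k 0 x y h hx.1, determinedBy_gapsLE m k x y h hx.2⟩

lemma determinedBy_noReturn (n : ℕ) : DeterminedBy n (noReturn n) := by
  intro x y h hx c h1 h2
  rw [← path_congr h h2]
  exact hx c h1 h2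

lemma mem_shift_noReturn {x : ℕ → ℤ × ℤ} {k : ℕ} (hk : path x k = 0) (n : ℕ) :
    shift k x ∈ noReturn n ↔ ∀ c, k < c → c ≤ k + n → path x c ≠ 0 := by
  constructor
  · intro h c h1 h2 h3
    obtain ⟨j, rfl⟩ := Nat.exists_eq_add_of_lt h1
    rw [add_assoc, path_add, hk, zero_add] at h3
    exact h (j + 1) (by omega) (by omega) h3
  · intro h c h1 h2 h3
    refine h (k + c) (by omega) (by omega) ?_
    rw [path_add, hk, h3, zero_add]

/-- The last zero up to time `n` is at time `k`. -/
def lastZero (n k : ℕ) : Set (ℕ → ℤ × ℤ) :=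
  {x | path x k = 0 ∧ ∀ c, k < c → c ≤ n → path x c ≠ 0}

lemma determinedBy_lastZero {n k : ℕ} (hk : k ≤ n) : DeterminedBy n (lastZero n k) := by
  intro x y h hx
  refine ⟨by rw [← path_congr h hk]; exact hx.1, fun c h1 h2 => ?_⟩
  rw [← path_congr h h2]
  exact hx.2 c h1 h2

lemma real_eq_sum_lastZero {A : Set (ℕ → ℤ × ℤ)} (hA : MeasurableSet A) (n : ℕ) :
    stepsLaw.real A = ∑ k ∈ Finset.range (n + 1), stepsLaw.real (A ∩ lastZero n k) := by
  rw [← measureReal_biUnion_finset]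
  · congr 1
    ext x
    simp only [Set.mem_iUnion, Set.mem_inter_iff, exists_and_left, exists_prop]
    refine ⟨fun hx => ⟨hx, ?_⟩, fun h => h.1⟩
    obtain ⟨k, hk, hk0, hc⟩ := exists_last_zero (path_zero x) n
    exact ⟨k, Finset.mem_range.2 (by omega), hk0, hc⟩
  · intro i hi j hj hij
    rw [Function.onFun, Set.disjoint_left]
    rintro x ⟨-, hx1, hx2⟩ ⟨-, hy1, hy2⟩
    simp only [Finset.coe_range, Set.mem_Iio] at hi hj
    rcases lt_or_gt_of_ne hij with h | h
    · exact hx2 j h (by omega) hy1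
    · exact hy2 i h (by omega) hx1
  · intro k hk
    exact hA.inter (determinedBy_lastZero (Nat.lt_succ_iff.1 (Finset.mem_range.1 hk))).measurableSet

/-- The tail of the first return time. -/
noncomputable def returnTail (n : ℕ) : ℝ := stepsLaw.real (noReturn n)

/-- The probability that `k` is a return time with no gap longer than `m` before. -/
noncomputable def renewalProb (m k : ℕ) : ℝ := stepsLaw.real (renewalEvent m k)

lemma returnTail_antitone : Antitone returnTail := fun _ _ h =>
  measureReal_mono fun _ hx c h1 h2 => hx c h1 (h2.trans h)

lemma returnTail_zero : returnTail 0 = 1 := by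
  have : noReturn 0 = Set.univ := by
    ext x
    simp only [noReturn, Set.mem_ofPred_eq, Set.mem_univ, iff_true]
    intro c h1 h2
    omega
  rw [returnTail, this, probReal_univ]

/-- Decomposition at the last zero. -/
lemma real_gapsLE_eq (m n : ℕ) : stepsLaw.real {x | GapsLE (path x) m n} =
    ∑ k ∈ Finset.range (n + 1), renewalProb m k * returnTail (n - k) := by
  rw [real_eq_sum_lastZero (determinedBy_gapsLE m n).measurableSet n]
  refine Finset.sum_congr rfl fun k hk => ?_
  have hkn : k ≤ n := Nat.lt_succ_iff.1 (Finset.mem_range.1 hk)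
  rw [renewalProb, returnTail, ← real_inter_shift (determinedBy_renewalEvent m k)
    (determinedBy_noReturn _).measurableSet]
  congr 1
  ext x
  simp only [Set.mem_inter_iff, Set.mem_ofPred_eq, lastZero, renewalEvent, Set.mem_preimage]
  constructor
  · rintro ⟨h1, h2, h3⟩
    refine ⟨⟨h2, h1.mono hkn⟩, (mem_shift_noReturn h2 _).2 fun c h4 h5 => h3 c h4 (by omega)⟩
  · rintro ⟨⟨h1, h2⟩, h3⟩
    rw [mem_shift_noReturn h1, Nat.add_sub_cancel' hkn] at h3
    exact ⟨(gapsLE_iff_of_last_zero hkn h3).2 h2, h1, h3⟩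

/-- If the last zero before `n + 1` is `k`, the final gap has length `n + 1 - k` with probability `r
(n - k) - r (n - k + 1)`, and it is admissible exactly when `n - k < m`. -/
lemma isTruncatedRenewal_renewalProb (m : ℕ) :
    IsTruncatedRenewal returnTail m (renewalProb m) where
  nonneg _ := measureReal_nonneg
  zero := by
    have : renewalEvent m 0 = Set.univ := by
      ext x
      simp only [renewalEvent, path_zero, true_and, Set.mem_ofPred_eq, Set.mem_univ, iff_true]
      exact gapsLE_of_le (Nat.zero_le m)
    rw [renewalProb, this, probReal_univ]
  succ n := by
    rw [renewalProb, real_eq_sum_lastZero (determinedBy_renewalEvent m (n + 1)).measurableSet n]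
    refine Finset.sum_congr rfl fun k hk => ?_
    have hkn : k ≤ n := Nat.lt_succ_iff.1 (Finset.mem_range.1 hk)
    have hsub : noReturn (n - k + 1) ⊆ noReturn (n - k) := fun x hx c h1 h2 =>
      hx c h1 (by omega)
    split_ifs with hm
    · rw [renewalProb, returnTail, returnTail,
        ← measureReal_sdiff hsub (determinedBy_noReturn _).measurableSet,
        ← real_inter_shift (determinedBy_renewalEvent m k)
        ((determinedBy_noReturn _).measurableSet.diff (determinedBy_noReturn _).measurableSet)]
      congr 1
      ext x
      simp only [Set.mem_inter_iff, lastZero, renewalEvent, Set.mem_preimage, Set.mem_ofPred_eq,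
        Set.mem_sdiff]
      constructor
      · rintro ⟨⟨h1, h2⟩, h3, h4⟩
        rw [mem_shift_noReturn h3, mem_shift_noReturn h3]
        refine ⟨⟨h3, h2.mono (by omega)⟩, fun c h5 h6 => h4 c h5 (by omega), fun h5 => ?_⟩
        exact h5 (n + 1) (by omega) (by omega) h1
      · rintro ⟨⟨h1, h2⟩, h3, h4⟩
        rw [mem_shift_noReturn h1] at h3 h4
        push Not at h4
        obtain ⟨c, h5, h6, h7⟩ := h4
        have hc : c = n + 1 := by
          by_contra hc
          exact h3 c h5 (by omega) h7
        subst hc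
        exact ⟨⟨h7, (gapsLE_iff_of_consecutive h5 h1 h7 fun c h8 h9 => h3 c h8 (by omega)).2
          ⟨h2, by omega⟩⟩, h1, fun c h8 h9 => h3 c h8 (by omega)⟩
    · rw [← measureReal_empty (μ := stepsLaw)]
      congr 1
      rw [Set.eq_empty_iff_forall_notMem]
      rintro x ⟨⟨h1, h2⟩, h3, h4⟩
      have := ((gapsLE_iff_of_consecutive (show k < n + 1 by omega) h3 h1
        fun c h8 h9 => h4 c h8 (by omega)).1 h2).2
      omega

lemma measurableSet_step_eq (z : ℤ × ℤ) : MeasurableSet {x : ℕ → ℤ × ℤ | x 0 = z} :=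
  measurable_pi_apply (X := fun _ : ℕ => ℤ × ℤ) 0 (measurableSet_singleton z)

lemma real_step_eq (z : ℤ × ℤ)
    (hz : z ∈ ({(0, 1), (0, -1), (1, 0), (-1, 0)} : Finset (ℤ × ℤ))) :
    stepsLaw.real {x | x 0 = z} = 1 / 4 := by
  have h := Measure.infinitePi_pi (fun _ : ℕ => stepLaw) (s := {0}) (t := fun _ => {z})
    fun _ _ => measurableSet_singleton z
  have h1 : stepLaw {z} = 4⁻¹ := by
    rw [stepLaw]
    simp only [Finset.mem_insert, Finset.mem_singleton] at hz
    rcases hz with rfl | rfl | rfl | rfl <;> simp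
  rw [Finset.prod_singleton, h1] at h
  have h2 : {x : ℕ → ℤ × ℤ | x 0 = z} = Set.pi ({0} : Finset ℕ) fun _ => {z} := by
    ext x
    simp
  rw [h2, Measure.real, stepsLaw, h]
  simp

lemma real_step_mem : stepsLaw.real {x | x 0 ∈ ({(0, 1), (0, -1), (1, 0), (-1, 0)} :
    Finset (ℤ × ℤ))} = 1 := by
  have h : {x : ℕ → ℤ × ℤ | x 0 ∈ ({(0, 1), (0, -1), (1, 0), (-1, 0)} : Finset (ℤ × ℤ))} =
      ⋃ z ∈ ({(0, 1), (0, -1), (1, 0), (-1, 0)} : Finset (ℤ × ℤ)), {x | x 0 = z} := by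
    ext x
    simp
  rw [h, measureReal_biUnion_finset, Finset.sum_congr rfl real_step_eq]
  · simp
  · intro a _ b _ hab
    rw [Function.onFun, Set.disjoint_left]
    intro x hx hy
    exact hab (hx.symm.trans hy)
  · intro z _
    exact measurableSet_step_eq z

/-- In the rotated coordinates `a + b` and `a - b` the four steps become the four sign pairs, so
these coordinates are independent simple walks on the line. -/
lemma real_path_eq (n : ℕ) (a b : ℤ) : stepsLaw.real {x | path x n = (a, b)} =
    lineWalkProb n (a + b) * lineWalkProb n (a - b) := by
  induction n generalizing a b with
  | zero =>
    simp only [path_zero, lineWalkProb]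
    by_cases h : a = 0 ∧ b = 0
    · obtain ⟨rfl, rfl⟩ := h
      simp [← Prod.zero_eq_mk]
    · have h1 : {x : ℕ → ℤ × ℤ | (0 : ℤ × ℤ) = (a, b)} = ∅ := by
        rw [Set.eq_empty_iff_forall_notMem]
        intro x hx
        simp only [Set.mem_ofPred_eq, Prod.ext_iff] at hx
        exact h ⟨hx.1.symm, hx.2.symm⟩
      rw [h1, measureReal_empty]
      split_ifs <;> first | omega | simp
  | succ n ih =>
    have hF : MeasurableSet {x : ℕ → ℤ × ℤ |
        x 0 ∈ ({(0, 1), (0, -1), (1, 0), (-1, 0)} : Finset (ℤ × ℤ))} :=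
      measurable_pi_apply (X := fun _ : ℕ => ℤ × ℤ) 0 (Finset.measurableSet _)
    have hae : ∀ᵐ x ∂stepsLaw, shift n x 0 ∈
        ({(0, 1), (0, -1), (1, 0), (-1, 0)} : Finset (ℤ × ℤ)) := by
      refine (mem_ae_iff_prob_eq_one (measurable_shift n hF)).2 ?_
      rw [← Measure.map_apply (measurable_shift n) hF, map_shift]
      exact (ENNReal.toReal_eq_one_iff _).1 real_step_mem
    have h1 : stepsLaw.real {x | path x (n + 1) = (a, b)} = stepsLaw.real
        (⋃ z ∈ ({(0, 1), (0, -1), (1, 0), (-1, 0)} : Finset (ℤ × ℤ)),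
          {x | path x n = (a, b) - z} ∩ shift n ⁻¹' {x | x 0 = z}) := by
      refine measureReal_congr ?_
      filter_upwards [hae] with x hx
      refine propext ?_
      change path x (n + 1) = (a, b) ↔ x ∈ ⋃ z ∈ _, _
      simp only [Set.mem_iUnion, Set.mem_inter_iff, Set.mem_ofPred_eq, Set.mem_preimage, exists_prop]
      have hp : path x (n + 1) = path x n + shift n x 0 := by
        rw [path_add]
        simp [path]
      rw [hp]
      constructor
      · intro h
        exact ⟨_, hx, by rw [← h]; simp, rfl⟩
      · rintro ⟨z, -, h2, h3⟩
        rw [h2, h3, sub_add_cancel]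
    rw [h1, measureReal_biUnion_finset]
    · have h2 : ∀ z ∈ ({(0, 1), (0, -1), (1, 0), (-1, 0)} : Finset (ℤ × ℤ)),
          stepsLaw.real ({x | path x n = (a, b) - z} ∩ shift n ⁻¹' {x | x 0 = z}) =
          lineWalkProb n (a - z.1 + (b - z.2)) * lineWalkProb n (a - z.1 - (b - z.2)) * (1 / 4) := by
        intro z hz
        rw [real_inter_shift (determinedBy_path n _) (measurableSet_step_eq z), real_step_eq z hz, ← ih]
        rfl
      rw [Finset.sum_congr rfl h2, lineWalkProb, lineWalkProb]
      rw [Finset.sum_insert (by decide), Finset.sum_insert (by decide),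
        Finset.sum_insert (by decide), Finset.sum_singleton]
      dsimp only
      rw [show a - 0 + (b - 1) = a + b - 1 by ring, show a - 0 - (b - 1) = a - b + 1 by ring,
        show a - 0 + (b - -1) = a + b + 1 by ring, show a - 0 - (b - -1) = a - b - 1 by ring,
        show a - 1 + (b - 0) = a + b - 1 by ring, show a - 1 - (b - 0) = a - b - 1 by ring,
        show a - -1 + (b - 0) = a + b + 1 by ring, show a - -1 - (b - 0) = a - b + 1 by ring]
      ring
    · intro y _ z _ hyz
      rw [Function.onFun, Set.disjoint_left]
      rintro x ⟨-, hx⟩ ⟨-, hy⟩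
      exact hyz (hx.symm.trans hy)
    · intro z _
      exact (determinedBy_path n _).measurableSet.inter (measurable_shift n
        (measurableSet_step_eq z))

lemma real_path_zero_even (k : ℕ) :
    stepsLaw.real {x | path x (2 * k) = 0} = evenReturnProb k := by
  have h := real_path_eq (2 * k) 0 0
  rw [add_zero, sub_zero, ← sq, lineWalkProb_sq_even] at h
  exact h

lemma real_path_zero_odd (k : ℕ) : stepsLaw.real {x | path x (2 * k + 1) = 0} = 0 := by
  have h := real_path_eq (2 * k + 1) 0 0
  rw [add_zero, lineWalkProb_odd, zero_mul] at h
  exact h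

/-- Take `m = n` in the last-zero decomposition: the gap condition becomes void. -/
lemma sum_returnProb_mul_tail (n : ℕ) : ∑ k ∈ Finset.range (n + 1),
    stepsLaw.real {x | path x k = 0} * returnTail (n - k) = 1 := by
  have h := real_gapsLE_eq n n
  have h1 : {x | GapsLE (path x) n n} = Set.univ :=
    Set.eq_univ_of_forall fun x => gapsLE_of_le le_rfl
  rw [h1, probReal_univ] at h
  rw [h]
  refine Finset.sum_congr rfl fun k hk => ?_
  rw [renewalProb]
  congr 2
  ext x
  simp only [renewalEvent, Set.mem_ofPred_eq]
  exact (and_iff_left (gapsLE_of_le (Nat.lt_succ_iff.1 (Finset.mem_range.1 hk)))).symm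

/-- The limiting distribution of the longest gap, on the space of step sequences. -/
lemma tendsto_real_gapsLE {x : ℝ} (hx0 : 0 < x) (hx1 : x < 1) :
    Tendsto (fun n : ℕ => stepsLaw.real {y | GapsLE (path y) ⌊(n : ℝ) ^ x⌋₊ n}) atTop (𝓝 x) := by
  obtain ⟨C, hC, hrC⟩ := exists_tendsto_tail_mul_log
    (p := fun k => stepsLaw.real {x | path x k = 0}) returnTail_antitone
    (fun _ => measureReal_nonneg) real_path_zero_even real_path_zero_odd sum_returnProb_mul_tail
  simp_rw [real_gapsLE_eq]
  exact tendsto_conv_truncatedRenewal returnTail_antitone returnTail_zero hC hrC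
    isTruncatedRenewal_renewalProb hx0 hx1

end Events

/-! ### Distribution functions and weak convergence -/

lemma measurable_maxExcursion (n : ℕ) :
    Measurable fun x : ℕ → ℤ × ℤ => maxExcursion (path x) n := by
  refine measurable_of_Iic fun m => ?_
  have : (fun x : ℕ → ℤ × ℤ => maxExcursion (path x) n) ⁻¹' Set.Iic m =
      {x | GapsLE (path x) m n} := by
    ext x
    exact maxExcursion_le_iff (path_zero x) m n
  rw [this]
  exact (determinedBy_gapsLE m n).measurableSet

/-- The normalized logarithm of the longest excursion completed by time `n`. -/
noncomputable def logRatio (n : ℕ) (x : ℕ → ℤ × ℤ) : ℝ :=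
  Real.log (maxExcursion (path x) n : ℝ) / Real.log (n : ℝ)

lemma measurable_logRatio (n : ℕ) : Measurable (logRatio n) :=
  (Real.measurable_log.comp ((measurable_from_top (f := fun k : ℕ => (k : ℝ))).comp
    (measurable_maxExcursion n))).div_const _

lemma logRatio_nonneg (n : ℕ) (x : ℕ → ℤ × ℤ) : 0 ≤ logRatio n x :=
  div_nonneg (Real.log_natCast_nonneg _) (Real.log_natCast_nonneg _)

lemma logRatio_le_iff {n : ℕ} (hn : 2 ≤ n) (x : ℕ → ℤ × ℤ) {t : ℝ} (ht : 0 ≤ t) :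
    logRatio n x ≤ t ↔ GapsLE (path x) ⌊(n : ℝ) ^ t⌋₊ n := by
  have hn0 : (0 : ℝ) < n := by exact_mod_cast (by omega : 0 < n)
  have hlog : 0 < Real.log n := Real.log_pos (by exact_mod_cast (by omega : 1 < n))
  rw [← maxExcursion_le_iff (path_zero x), Nat.le_floor_iff (by positivity), logRatio,
    div_le_iff₀ hlog]
  -- With no completed excursion, `Real.log 0 = 0` makes the quotient 0, as the convention demands,
  -- and both sides hold.
  rcases Nat.eq_zero_or_pos (maxExcursion (path x) n) with h | h
  · rw [h]
    simp only [Nat.cast_zero, Real.log_zero]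
    exact iff_of_true (by positivity) (by positivity)
  · rw [← Real.log_rpow hn0, Real.log_le_log_iff (by exact_mod_cast h) (by positivity)]

lemma tendsto_real_logRatio_le (t : ℝ) :
    Tendsto (fun n : ℕ => stepsLaw.real {x | logRatio n x ≤ t}) atTop (𝓝 (max 0 (min t 1))) := by
  rcases lt_trichotomy t 0 with ht | rfl | ht
  · rw [min_eq_left (by linarith), max_eq_left ht.le]
    refine tendsto_const_nhds.congr fun n => ?_
    have : {x | logRatio n x ≤ t} = ∅ := by
      rw [Set.eq_empty_iff_forall_notMem]
      intro x hx
      exact absurd (logRatio_nonneg n x) (not_le.2 (lt_of_le_of_lt hx ht))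
    rw [this, measureReal_empty]
  · rw [min_eq_left zero_le_one, max_self]
    refine tendsto_order.2 ⟨fun a ha => Eventually.of_forall fun n =>
      ha.trans_le measureReal_nonneg, fun a ha => ?_⟩
    -- The level `t = 0` is outside the range of `tendsto_real_gapsLE`; monotonicity in the level
    -- bounds it by any small `s > 0`.
    obtain ⟨s, hs0, hs⟩ := exists_between (lt_min ha one_pos)
    filter_upwards [(tendsto_real_gapsLE hs0 (hs.trans_le (min_le_right _ _))).eventually_lt_const
      (hs.trans_le (min_le_left _ _)), eventually_ge_atTop 2] with n hn hn2
    refine lt_of_le_of_lt (measureReal_mono fun x hx => ?_) hn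
    exact (logRatio_le_iff hn2 x hs0.le).1 (le_trans hx hs0.le)
  · rcases lt_or_ge t 1 with ht1 | ht1
    · rw [min_eq_left ht1.le, max_eq_right ht.le]
      refine (tendsto_real_gapsLE ht ht1).congr' ?_
      filter_upwards [eventually_ge_atTop 2] with n hn
      congr 1
      ext x
      exact (logRatio_le_iff hn x ht.le).symm
    · rw [min_eq_right ht1, max_eq_right zero_le_one]
      refine tendsto_const_nhds.congr' ?_
      filter_upwards [eventually_ge_atTop 2] with n hn
      have : {x | logRatio n x ≤ t} = Set.univ := by
        refine Set.eq_univ_of_forall fun x => ?_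
        refine (logRatio_le_iff hn x ht.le).2 (gapsLE_of_le (Nat.le_floor ?_))
        calc (n : ℝ) = (n : ℝ) ^ (1 : ℝ) := (Real.rpow_one _).symm
          _ ≤ _ := Real.rpow_le_rpow_of_exponent_le (by exact_mod_cast (by omega : 1 ≤ n)) ht1
      rw [this, probReal_univ]

/-- Convergence of distribution functions implies weak convergence. -/
lemma tendsto_probabilityMeasure_of_tendsto_Iic {μ : ℕ → ProbabilityMeasure ℝ}
    {ν : ProbabilityMeasure ℝ} (h : ∀ t : ℝ, Tendsto (fun n => (μ n : Measure ℝ).real (Set.Iic t))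
      atTop (𝓝 ((ν : Measure ℝ).real (Set.Iic t)))) : Tendsto μ atTop (𝓝 ν) := by
  have hS : IsPiSystem {S : Set ℝ | ∃ l u : ℝ, l < u ∧ Set.Ioc l u = S} := by
    simpa using isPiSystem_Ioc (α := ℝ) id id
  -- Half-open intervals form a π-system containing arbitrarily small neighbourhoods of each point,
  -- and their masses are differences of distribution functions.
  refine hS.tendsto_probabilityMeasure_of_tendsto_of_mem ?_ ?_ ?_
  · rintro _ ⟨l, u, -, rfl⟩
    exact measurableSet_Ioc
  · intro U hU x hx
    obtain ⟨ε, hε, hb⟩ := Metric.isOpen_iff.1 hU x hx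
    refine ⟨Set.Ioc (x - ε / 2) (x + ε / 2), ⟨_, _, by linarith, rfl⟩,
      Ioc_mem_nhds (by linarith) (by linarith), fun y hy => hb ?_⟩
    rw [Metric.mem_ball, Real.dist_eq, abs_lt]
    constructor <;> linarith [hy.1, hy.2]
  · rintro _ ⟨l, u, hlu, rfl⟩
    have hd : ∀ ρ : ProbabilityMeasure ℝ, (ρ : Measure ℝ).real (Set.Ioc l u) =
        (ρ : Measure ℝ).real (Set.Iic u) - (ρ : Measure ℝ).real (Set.Iic l) := by
      intro ρ
      rw [← Set.Iic_sdiff_Iic, measureReal_sdiff (Set.Iic_subset_Iic.2 hlu.le) measurableSet_Iic]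
    have h1 := (h u).sub (h l)
    simp only [← hd] at h1
    exact NNReal.tendsto_coe.1 h1

lemma uniform_real_Iic {Ω' : Type*} [MeasurableSpace Ω'] {P' : Measure Ω'} {U : Ω' → ℝ}
    (hU : pdf.IsUniform U (Set.Icc (0 : ℝ) 1) P' volume) (t : ℝ) :
    (P'.map U).real (Set.Iic t) = max 0 (min t 1) := by
  have h : P'.map U = ProbabilityTheory.cond volume (Set.Icc (0 : ℝ) 1) := hU
  have hI : Set.Icc (0 : ℝ) 1 ∩ Set.Iic t = Set.Icc 0 (min t 1) := by
    ext y
    simp only [Set.mem_inter_iff, Set.mem_Icc, Set.mem_Iic, le_min_iff]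
    tauto
  rw [h, Measure.real, cond_apply measurableSet_Icc, hI, Real.volume_Icc, Real.volume_Icc]
  rw [sub_zero, sub_zero, ENNReal.ofReal_one, inv_one, one_mul, ENNReal.toReal_ofReal', max_comm]

end PlanarWalk

theorem proposition1 {Ω : Type*} [MeasurableSpace Ω] (P : Measure Ω) [IsProbabilityMeasure P]
    (ξ : ℕ → Ω → ℤ × ℤ) (hξ : PlanarWalk.IsSimpleStep P ξ)
    {Ω' : Type*} [MeasurableSpace Ω'] (P' : Measure Ω') [IsProbabilityMeasure P']
    (UNI : Ω' → ℝ) (hUNI : pdf.IsUniform UNI (Set.Icc (0 : ℝ) 1) P' volume) :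
    TendstoInDistribution
      (fun (n : ℕ) (ω : Ω) =>
        Real.log (PlanarWalk.maxExcursion (PlanarWalk.walk ξ ω) n : ℝ) / Real.log (n : ℝ))
      atTop UNI (fun _ => P) P' := by
  have hsteps : Measurable fun ω i => ξ i ω := measurable_pi_lambda _ hξ.measurable
  have hX : ∀ n : ℕ, Measurable fun ω => Real.log (PlanarWalk.maxExcursion
      (PlanarWalk.walk ξ ω) n : ℝ) / Real.log (n : ℝ) := fun n =>
    (PlanarWalk.measurable_logRatio n).comp hsteps
  refine ⟨fun n => (hX n).aemeasurable, hUNI.aemeasurable (by simp) (by simp), ?_⟩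
  refine PlanarWalk.tendsto_probabilityMeasure_of_tendsto_Iic fun t => ?_
  simp only [ProbabilityMeasure.coe_mk]
  rw [PlanarWalk.uniform_real_Iic hUNI]
  refine (PlanarWalk.tendsto_real_logRatio_le t).congr fun n => ?_
  have hm : MeasurableSet {x | PlanarWalk.logRatio n x ≤ t} :=
    PlanarWalk.measurable_logRatio n measurableSet_Iic
  -- The law of the steps is `stepsLaw`, so the probability can be computed on the canonical space.
  rw [Measure.real, Measure.real, Measure.map_apply (hX n) measurableSet_Iic,
    ← PlanarWalk.map_steps_eq hξ, Measure.map_apply hsteps hm]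
  rfl
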